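/- **Setting.** Let $B\in\mathbb{R}^{d_r\times d_c}$ be a nonzero matrix (the mean rewards of the $d_rd_c$ arms of a bandit), of rank $\mathfrak r$, with smallest nonzero singular value $D_{\mathfrak r\mathfrak r}$ and with largest row norm $\|B\|_{\infty,2}=\max_j(\sum_k B_{jk}^2)^{1/2}\le b^*$. Let $$\mu^*=\sqrt{\tfrac{d_r}{\mathfrak r}}\,\frac{\|B\|_{\infty,2}}{D_{\mathfrak r\mathfrak r}},\qquad \gamma(h)=\sqrt{\tfrac{d_r}{\mathfrak r}}\,\frac{h}{64\mu^*},\qquad g(h)=\#\{(j,k): B_{jk}\ge \max B-h\}.$$ Let $C_1,\alpha_2,\alpha_4,\alpha_5,\sigma>0$ be constants ($\sigma$ is the subgaussian parameter of the noise, $\sigma=1$ for 1-subgaussian noise), let $T\ge 1$ be the time horizon, and put $$h_{\mathrm{low}}(T)=\max\Big\{64\mu^*\sqrt{\tfrac{2\alpha_4\mathfrak r}{Td_r}},\ \tfrac{2\alpha_5}{T}\Big\},\qquad \rho(h)=2\alpha_2\big(1+\gamma(h)^{-2}\big)\mathfrak r(d_r+d_c),$$ $$\phi_1(h)=C_1\alpha_2b^*\big(1+\gamma(h)^{-2}\big)\mathfrak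 r(d_r+d_c)\log T=\tfrac12C_1b^*\rho(h)\log T,\qquad \phi_2(h)=4\sigma\sqrt{2T\,g(h)\log T}.$$ Here $h$ is the filtering resolution and $\rho$ the forced-sampling parameter of the Low-Rank Bandit algorithm. Up to additive constants that do not depend on $h$ and $T$ and are omitted throughout, its gap-independent regret upper bound is $\overline{\mathrm{Regret}}_T(h)=\phi_1(h)+\phi_2(h)$; with a general forced-sampling parameter $\rho$ it is $\overline{\mathrm{Regret}}_T(\rho,h)=\tfrac12C_1b^*\rho\log T+\phi_2(h)$, so that $\overline{\mathrm{Regret}}_T(h)=\overline{\mathrm{Regret}}_T(\rho(h),h)$. Assume that the range $I=[h_{\mathrm{low}}(T),2b^*]$ of admissible resolutions is nonempty. Call $\tilde h\in I$ *optimal up to a factor of 2* if $\overline{\mathrm{Regret}}_T(\tilde h)\le 2\,\overline{\mathrm{Regret}}_T(h)$ for every $h\in I$, in particular for $h=h^*$ whenever a minimiser $h^*$ of $\overline{\mathrm{Regret}}_T$ over $I$ exists. **Lemma (Best filtering resolution).** On $I$ the function $\phi_1$ is decreasing and $\phi_2$ is increasing (both in the weak sense), and: 1. If $\phi_1(h)<\phi_2(h)$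 for all $h\in I$, then $\tilde h=h_{\mathrm{low}}(T)$ is optimal up to a factor of 2, and $$\overline{\mathrm{Regret}}_T(h_{\mathrm{low}}(T))\le 8\sigma\sqrt{2T\,g(h_{\mathrm{low}}(T))\log T}.$$ 2. If $\phi_1(\tilde h)=\phi_2(\tilde h)$ for some $\tilde h\in I$, then $\tilde h$ is optimal up to a factor of 2. 3. If $\phi_1(h)>\phi_2(h)$ for all $h\in I$, then $\tilde h=2b^*$ is optimal up to a factor of 2; moreover, with the forced-sampling parameter set to $\rho=0$, the regret upper bound at $h=2b^*$ satisfies $$\overline{\mathrm{Regret}}_T(0,2b^*)\le 4\sigma\sqrt{2T\,d_rd_c\log T}.$$ The same holds for the gap-dependent bound: if not all entries of $B$ are equal and $\Delta$ is the difference between $\max B$ and the largest entry that is smaller than $\max B$, then everything above remains true with $\phi_2$ replaced by $\frac{8g(h)\log T}{\Delta}+(1+\frac{\pi^2}{3})\,h\,g(h)$, where the explicit bound in case 1 becomes $2\big(\frac{8g(h)\log T}{\Delta}+(1+\frac{\pi^2}{3})h\,g(h)\big)$ at $h=h_{\mathrm{low}}(T)$, and the one in case 3 becomes $\frac{8d_rd_c\log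 T}{\Delta}+(1+\frac{\pi^2}{3})\,2b^*d_rd_c$. -/

import Mathlib

namespace LowRankBandit

noncomputable section

/-- The largest mean reward `max_{j,k} B_{jk}`. -/
def maxEntry {dr dc : ℕ} (B : Matrix (Fin dr) (Fin dc) ℝ) : ℝ :=
  ⨆ a : Fin dr × Fin dc, B a.1 a.2

/-- The gap `Δ_{jk} = max B - B_{jk}` of the arm `a = (j, k)`. -/
def armGap {dr dc : ℕ} (B : Matrix (Fin dr) (Fin dc) ℝ) (a : Fin dr × Fin dc) : ℝ :=
  maxEntry B - B a.1 a.2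

/-- The gap `Δ`: the smallest positive gap of an arm. -/
def minGap {dr dc : ℕ} (B : Matrix (Fin dr) (Fin dc) ℝ) : ℝ :=
  sInf {δ : ℝ | 0 < δ ∧ ∃ a : Fin dr × Fin dc, armGap B a = δ}

open Classical in
/-- The near-optimal set: the arms whose mean reward is at least `max B - h`. -/
def nearOptSet {dr dc : ℕ} (B : Matrix (Fin dr) (Fin dc) ℝ) (h : ℝ) :
    Finset (Fin dr × Fin dc) :=
  Finset.univ.filter fun a => maxEntry B - h ≤ B a.1 a.2

/-- The near-optimal function `g(h)`: the number of near-optimal arms. -/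
def nearOptFun {dr dc : ℕ} (B : Matrix (Fin dr) (Fin dc) ℝ) (h : ℝ) : ℕ :=
  (nearOptSet B h).card

/-- `‖B‖_{∞,2}`: the largest `ℓ²`-norm of a row. -/
def rowNorm {dr dc : ℕ} (B : Matrix (Fin dr) (Fin dc) ℝ) : ℝ :=
  ⨆ j : Fin dr, √(∑ k, |B j k| ^ 2)

/-- `D_{rr}`: the `r`-th largest singular value of `B`, where `r` is the rank of `B`
(Mathlib numbers singular values from `0`, in decreasing order). -/
def lastSingularValue {dr dc : ℕ} (B : Matrix (Fin dr) (Fin dc) ℝ) : ℝ :=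
  (Matrix.toEuclideanLin B).singularValues (B.rank - 1)

/-- The row-incoherence parameter `μ(B) = √(d_r / r) ‖B‖_{∞,2} / D_{rr}`. -/
def rowIncoherence {dr dc : ℕ} (B : Matrix (Fin dr) (Fin dc) ℝ) : ℝ :=
  √((dr : ℝ) / B.rank) * (rowNorm B / lastSingularValue B)

/-- `γ(h) = √(d_r / r) h / (64 μ(B))`. -/
def gammaFun {dr dc : ℕ} (B : Matrix (Fin dr) (Fin dc) ℝ) (h : ℝ) : ℝ :=
  √((dr : ℝ) / B.rank) * (h / (64 * rowIncoherence B))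

/-- The forced-sampling parameter
`ρ(h) = 2 α₂ (1 + γ(h)⁻²) r (d_r + d_c)`. -/
def forcedRho {dr dc : ℕ} (B : Matrix (Fin dr) (Fin dc) ℝ) (α₂ h : ℝ) : ℝ :=
  2 * α₂ * (1 + (gammaFun B h ^ 2)⁻¹) * B.rank * ((dr : ℝ) + dc)

/-- The finest admissible filtering resolution
`h_low(T) = max {64 μ(B) √(2 α₄ r / (T d_r)), 2 α₅ / T}`. -/
def hLow {dr dc : ℕ} (B : Matrix (Fin dr) (Fin dc) ℝ) (α₄ α₅ : ℝ) (T : ℕ) : ℝ :=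
  max (64 * rowIncoherence B * √(2 * α₄ * B.rank / (T * dr))) (2 * α₅ / T)

/-- The admissible filtering resolutions `[h_low(T), 2 b]`. -/
def resolutionRange {dr dc : ℕ} (B : Matrix (Fin dr) (Fin dc) ℝ) (b α₄ α₅ : ℝ) (T : ℕ) :
    Set ℝ :=
  Set.Icc (hLow B α₄ α₅ T) (2 * b)

/-- The bound on the cost of the forced-sampling phase, at resolution `h`:
`φ₁(h; T) = C₁ α₂ b (1 + γ(h)⁻²) r (d_r + d_c) log T`. -/
def phi1 {dr dc : ℕ} (B : Matrix (Fin dr) (Fin dc) ℝ) (b C₁ α₂ : ℝ) (T : ℕ) (h : ℝ) : ℝ :=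
  C₁ * (α₂ * b * (1 + 1 / gammaFun B h ^ 2) * B.rank * ((dr : ℝ) + dc) * Real.log T)

/-- The gap-independent bound on the cost of the UCB phase, at resolution `h`:
`φ₂(h; T) = 4 σ √(2 T g(h) log T)`. -/
def phi2 {dr dc : ℕ} (B : Matrix (Fin dr) (Fin dc) ℝ) (σ : ℝ) (T : ℕ) (h : ℝ) : ℝ :=
  4 * σ * √(2 * T * nearOptFun B h * Real.log T)

/-- The gap-dependent bound on the cost of the UCB phase, at resolution `h`:
`8 g(h) log T / Δ + (1 + π² / 3) h g(h)`. -/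
def phi2Gap {dr dc : ℕ} (B : Matrix (Fin dr) (Fin dc) ℝ) (T : ℕ) (h : ℝ) : ℝ :=
  8 * nearOptFun B h * Real.log T / minGap B + (1 + Real.pi ^ 2 / 3) * h * nearOptFun B h

/-- The gap-independent regret upper bound `φ₁(h; T) + φ₂(h; T)`. -/
def regretBound {dr dc : ℕ} (B : Matrix (Fin dr) (Fin dc) ℝ) (b C₁ α₂ σ : ℝ) (T : ℕ)
    (h : ℝ) : ℝ :=
  phi1 B b C₁ α₂ T h + phi2 B σ T h

/-- The gap-dependent regret upper bound. -/
def regretBoundGap {dr dc : ℕ} (B : Matrix (Fin dr) (Fin dc) ℝ) (b C₁ α₂ : ℝ) (T : ℕ)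
    (h : ℝ) : ℝ :=
  phi1 B b C₁ α₂ T h + phi2Gap B T h

/-- The bound on the cost of the forced-sampling phase, as a function of the forced-sampling
parameter `ρ`; it is `φ₁(h; T)` when `ρ = ρ(h)`. -/
def phi1Rho (b C₁ : ℝ) (T : ℕ) (ρ : ℝ) : ℝ :=
  C₁ * (b * (ρ / 2) * Real.log T)

/-- The gap-independent regret upper bound when the forced-sampling parameter is `ρ` and the
filtering resolution is `h`. -/
def regretBoundRho {dr dc : ℕ} (B : Matrix (Fin dr) (Fin dc) ℝ) (b C₁ σ : ℝ) (T : ℕ)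
    (ρ h : ℝ) : ℝ :=
  phi1Rho b C₁ T ρ + phi2 B σ T h

/-- The gap-dependent regret upper bound when the forced-sampling parameter is `ρ` and the
filtering resolution is `h`. -/
def regretBoundGapRho {dr dc : ℕ} (B : Matrix (Fin dr) (Fin dc) ℝ) (b C₁ : ℝ) (T : ℕ)
    (ρ h : ℝ) : ℝ :=
  phi1Rho b C₁ T ρ + phi2Gap B T h

/-- `x` minimises `R` over `I` up to a factor of `2`. In particular `R x ≤ 2 * R h` for
every minimiser `h` of `R` over `I`, if there is one. -/
def OptimalUpToTwo (R : ℝ → ℝ) (I : Set ℝ) (x : ℝ) : Prop :=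
  x ∈ I ∧ ∀ h ∈ I, R x ≤ 2 * R h

end

end LowRankBandit

/-!
The forced-sampling cost `φ₁` depends on the resolution `h` only through `γ(h)⁻²`, where `γ` is
linear in `h` with a positive slope (`gammaFun_pos`, `gammaFun_mono`: a nonzero matrix has positive
rank, row norm and last singular value). Hence `φ₁` decreases on the admissible range, all of whose
elements are positive. The near-optimal set grows with `h`, so either UCB cost increases.

The rest concerns the sum of a nonnegative antitone function `f` and a nonnegative monotone
function `g` on an interval. At a point the sum is at most twice its larger summand, and for
the factor two it suffices that this summand does not exceed its own value at the competitor. If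
`f < g` throughout, the left endpoint has this property, because `g` is least there; if `g < f`
throughout, the right endpoint has it. At a point where `f = g`, either summand may be taken as
the larger one: `f` against competitors on the left, `g` against those on the right.
-/

namespace LowRankBandit

/-! ### Minimising a decreasing plus an increasing function up to a factor of two -/

theorem optimalUpToTwo_left {f g : ℝ → ℝ} {l u : ℝ} (hlu : l ≤ u)
    (hg : MonotoneOn g (Set.Icc l u)) (hf0 : ∀ h ∈ Set.Icc l u, 0 ≤ f h)
    (hfg : f l ≤ g l) :
    OptimalUpToTwo (fun h => f h + g h) (Set.Icc l u) l := by
  have hl : l ∈ Set.Icc l u := Set.left_mem_Icc.2 hlu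
  refine ⟨hl, fun h hh => ?_⟩
  have h₁ := hg hl hh hh.1
  have h₂ := hf0 h hh
  show f l + g l ≤ 2 * (f h + g h)
  linarith

theorem optimalUpToTwo_right {f g : ℝ → ℝ} {l u : ℝ} (hlu : l ≤ u)
    (hf : AntitoneOn f (Set.Icc l u)) (hg0 : ∀ h ∈ Set.Icc l u, 0 ≤ g h)
    (hgf : g u ≤ f u) :
    OptimalUpToTwo (fun h => f h + g h) (Set.Icc l u) u := by
  have hu : u ∈ Set.Icc l u := Set.right_mem_Icc.2 hlu
  refine ⟨hu, fun h hh => ?_⟩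
  have h₁ := hf hh hu hh.2
  have h₂ := hg0 h hh
  show f u + g u ≤ 2 * (f h + g h)
  linarith

theorem optimalUpToTwo_of_eq {f g : ℝ → ℝ} {s : Set ℝ} {x : ℝ} (hx : x ∈ s)
    (hf : AntitoneOn f s) (hg : MonotoneOn g s)
    (hf0 : ∀ h ∈ s, 0 ≤ f h) (hg0 : ∀ h ∈ s, 0 ≤ g h) (hfg : f x = g x) :
    OptimalUpToTwo (fun h => f h + g h) s x := by
  refine ⟨hx, fun h hh => ?_⟩
  have hf0h := hf0 h hh
  have hg0h := hg0 h hh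
  show f x + g x ≤ 2 * (f h + g h)
  rcases le_total h x with hle | hle
  · have := hf hh hx hle
    linarith
  · have := hg hx hh hle
    linarith

variable {dr dc : ℕ} {B : Matrix (Fin dr) (Fin dc) ℝ}

/-! ### Positivity of the incoherence parameter -/

theorem rank_pos_of_ne_zero (hB : B ≠ 0) : 0 < B.rank := by
  rw [Nat.pos_iff_ne_zero, Ne, Matrix.rank_eq_finrank_range_toLin B
    (PiLp.basisFun 2 ℝ (Fin dr)) (PiLp.basisFun 2 ℝ (Fin dc)), Submodule.finrank_eq_zero,
    LinearMap.range_eq_bot]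
  simpa using hB

theorem dr_pos_of_ne_zero (hB : B ≠ 0) : 0 < dr := by
  have h := B.rank_le_card_height
  rw [Fintype.card_fin] at h
  exact (rank_pos_of_ne_zero hB).trans_le h

theorem lastSingularValue_pos (hB : B ≠ 0) : 0 < lastSingularValue B := by
  have hr := rank_pos_of_ne_zero hB
  rw [lastSingularValue, LinearMap.singularValues_pos_iff_lt_finrank_range,
    Matrix.toEuclideanLin, Matrix.toLpLin_eq_toLin, ← Matrix.rank_eq_finrank_range_toLin]
  omega

theorem rowNorm_pos (hB : B ≠ 0) : 0 < rowNorm B := by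
  obtain ⟨j, k, hjk⟩ : ∃ j k, B j k ≠ 0 := by
    by_contra! h
    exact hB (Matrix.ext h)
  have hrow : 0 < √(∑ k, |B j k| ^ 2) :=
    Real.sqrt_pos.2 (Finset.sum_pos' (fun _ _ => by positivity)
      ⟨k, Finset.mem_univ k, by positivity⟩)
  exact hrow.trans_le (le_ciSup (f := fun j => √(∑ k, |B j k| ^ 2)) (Set.finite_range _).bddAbove j)

theorem sqrt_dr_div_rank_pos (hB : B ≠ 0) : 0 < √((dr : ℝ) / B.rank) :=
  Real.sqrt_pos.2 (div_pos (Nat.cast_pos.2 (dr_pos_of_ne_zero hB))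
    (Nat.cast_pos.2 (rank_pos_of_ne_zero hB)))

theorem rowIncoherence_pos (hB : B ≠ 0) : 0 < rowIncoherence B :=
  mul_pos (sqrt_dr_div_rank_pos hB) (div_pos (rowNorm_pos hB) (lastSingularValue_pos hB))

theorem gammaFun_pos (hB : B ≠ 0) {h : ℝ} (hh : 0 < h) : 0 < gammaFun B h :=
  mul_pos (sqrt_dr_div_rank_pos hB)
    (div_pos hh (mul_pos (by norm_num) (rowIncoherence_pos hB)))

theorem gammaFun_mono (hB : B ≠ 0) : Monotone (gammaFun B) := by
  intro h h' hle
  have := rowIncoherence_pos hB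
  unfold gammaFun
  gcongr

/-! ### The near-optimal arms and the gap -/

theorem nearOptFun_mono : Monotone (nearOptFun B) := by
  intro h h' hle
  refine Finset.card_le_card fun a ha => ?_
  simp only [nearOptSet, Finset.mem_filter, Finset.mem_univ, true_and] at ha ⊢
  linarith

theorem nearOptFun_le (h : ℝ) : (nearOptFun B h : ℝ) ≤ dr * dc := by
  have : nearOptFun B h ≤ dr * dc := by
    simpa [nearOptFun] using (nearOptSet B h).card_le_univ
  exact_mod_cast this

/-- The gap is attained by one of the finitely many suboptimal arms, so it is positive. -/
theorem minGap_pos (hgap : ∃ a : Fin dr × Fin dc, 0 < armGap B a) : 0 < minGap B := by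
  obtain ⟨a, ha⟩ := hgap
  have hfin : {δ : ℝ | 0 < δ ∧ ∃ a : Fin dr × Fin dc, armGap B a = δ}.Finite :=
    (Set.finite_range (armGap B)).subset fun _ hδ => hδ.2
  have hne : {δ : ℝ | 0 < δ ∧ ∃ a : Fin dr × Fin dc, armGap B a = δ}.Nonempty :=
    ⟨armGap B a, ha, a, rfl⟩
  exact (hne.csInf_mem hfin).1

/-! ### The two costs as functions of the resolution -/

theorem hLow_pos (α₄ : ℝ) {α₅ : ℝ} (hα₅ : 0 < α₅) {T : ℕ} (hT : 1 ≤ T) :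
    0 < hLow B α₄ α₅ T := by
  have : (0 : ℝ) < T := by exact_mod_cast hT
  exact lt_max_of_lt_right (by positivity)

theorem phi1_nonneg {b C₁ α₂ : ℝ} (hb : 0 ≤ b) (hC₁ : 0 ≤ C₁) (hα₂ : 0 ≤ α₂) (T : ℕ) (h : ℝ) :
    0 ≤ phi1 B b C₁ α₂ T h := by
  have := Real.log_natCast_nonneg T
  unfold phi1
  positivity

theorem phi1_antitoneOn (hB : B ≠ 0) {b C₁ α₂ : ℝ} (hb : 0 ≤ b) (hC₁ : 0 ≤ C₁) (hα₂ : 0 ≤ α₂)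
    (T : ℕ) : AntitoneOn (phi1 B b C₁ α₂ T) (Set.Ioi 0) := by
  intro h hh h' _ hle
  have hlog := Real.log_natCast_nonneg T
  have hγ := gammaFun_pos hB hh
  have hγle := gammaFun_mono hB hle
  unfold phi1
  gcongr

theorem phi1_eq_phi1Rho (b C₁ α₂ : ℝ) (T : ℕ) (h : ℝ) :
    phi1 B b C₁ α₂ T h = phi1Rho b C₁ T (forcedRho B α₂ h) := by
  unfold phi1 phi1Rho forcedRho
  ring

theorem phi1Rho_zero (b C₁ : ℝ) (T : ℕ) : phi1Rho b C₁ T 0 = 0 := by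
  simp [phi1Rho]

theorem phi2_nonneg {σ : ℝ} (hσ : 0 ≤ σ) (T : ℕ) (h : ℝ) : 0 ≤ phi2 B σ T h := by
  unfold phi2
  positivity

theorem phi2_mono {σ : ℝ} (hσ : 0 ≤ σ) (T : ℕ) : Monotone (phi2 B σ T) := by
  intro h h' hle
  have hlog := Real.log_natCast_nonneg T
  have hg := nearOptFun_mono (B := B) hle
  unfold phi2
  gcongr

theorem phi2_le {σ : ℝ} (hσ : 0 ≤ σ) (T : ℕ) (h : ℝ) :
    phi2 B σ T h ≤ 4 * σ * √(2 * T * (dr * dc) * Real.log T) := by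
  have hlog := Real.log_natCast_nonneg T
  have hg := nearOptFun_le (B := B) h
  unfold phi2
  gcongr

theorem phi2Gap_nonneg (hΔ : 0 < minGap B) (T : ℕ) {h : ℝ} (hh : 0 ≤ h) :
    0 ≤ phi2Gap B T h := by
  have hlog := Real.log_natCast_nonneg T
  unfold phi2Gap
  positivity

theorem phi2Gap_monotoneOn (hΔ : 0 < minGap B) (T : ℕ) :
    MonotoneOn (phi2Gap B T) (Set.Ioi 0) := by
  intro h hh h' hh' hle
  have hh : 0 < h := hh
  have hh' : 0 < h' := hh'
  have hlog := Real.log_natCast_nonneg T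
  have hg := nearOptFun_mono (B := B) hle
  unfold phi2Gap
  gcongr

theorem phi2Gap_le (hΔ : 0 < minGap B) (T : ℕ) {h : ℝ} (hh : 0 ≤ h) :
    phi2Gap B T h ≤
      8 * (dr * dc) * Real.log T / minGap B + (1 + Real.pi ^ 2 / 3) * h * (dr * dc) := by
  have hlog := Real.log_natCast_nonneg T
  have hg := nearOptFun_le (B := B) h
  unfold phi2Gap
  gcongr

end LowRankBandit

/-! ### The best filtering resolution -/

theorem lemma2 {dr dc : ℕ} (B : Matrix (Fin dr) (Fin dc) ℝ) (hB : B ≠ 0)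
    (b : ℝ) (hb : LowRankBandit.rowNorm B ≤ b)
    (C₁ α₂ α₄ α₅ σ : ℝ) (hC₁ : 0 < C₁) (hα₂ : 0 < α₂) (hα₄ : 0 < α₄) (hα₅ : 0 < α₅)
    (hσ : 0 < σ) (T : ℕ) (hT : 1 ≤ T)
    (hrange : LowRankBandit.hLow B α₄ α₅ T ≤ 2 * b) :
    -- the forced-sampling cost decreases and the UCB cost increases with the resolution
    (AntitoneOn (LowRankBandit.phi1 B b C₁ α₂ T) (LowRankBandit.resolutionRange B b α₄ α₅ T) ∧
      MonotoneOn (LowRankBandit.phi2 B σ T) (LowRankBandit.resolutionRange B b α₄ α₅ T)) ∧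
    -- the bound at resolution `h` is the one with forced-sampling parameter `ρ(h)`
    (∀ h ∈ LowRankBandit.resolutionRange B b α₄ α₅ T,
      LowRankBandit.regretBound B b C₁ α₂ σ T h =
        LowRankBandit.regretBoundRho B b C₁ σ T (LowRankBandit.forcedRho B α₂ h) h) ∧
    -- case (1)
    ((∀ h ∈ LowRankBandit.resolutionRange B b α₄ α₅ T,
        LowRankBandit.phi1 B b C₁ α₂ T h < LowRankBandit.phi2 B σ T h) →
      LowRankBandit.OptimalUpToTwo (LowRankBandit.regretBound B b C₁ α₂ σ T)
        (LowRankBandit.resolutionRange B b α₄ α₅ T) (LowRankBandit.hLow B α₄ α₅ T) ∧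
      LowRankBandit.regretBound B b C₁ α₂ σ T (LowRankBandit.hLow B α₄ α₅ T) ≤
        8 * σ * √(2 * T * LowRankBandit.nearOptFun B (LowRankBandit.hLow B α₄ α₅ T) *
          Real.log T)) ∧
    -- case (2)
    (∀ h' ∈ LowRankBandit.resolutionRange B b α₄ α₅ T,
      LowRankBandit.phi1 B b C₁ α₂ T h' = LowRankBandit.phi2 B σ T h' →
      LowRankBandit.OptimalUpToTwo (LowRankBandit.regretBound B b C₁ α₂ σ T)
        (LowRankBandit.resolutionRange B b α₄ α₅ T) h') ∧
    -- case (3); the explicit bound is for forced-sampling parameter `0`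
    ((∀ h ∈ LowRankBandit.resolutionRange B b α₄ α₅ T,
        LowRankBandit.phi2 B σ T h < LowRankBandit.phi1 B b C₁ α₂ T h) →
      LowRankBandit.OptimalUpToTwo (LowRankBandit.regretBound B b C₁ α₂ σ T)
        (LowRankBandit.resolutionRange B b α₄ α₅ T) (2 * b) ∧
      LowRankBandit.regretBoundRho B b C₁ σ T 0 (2 * b) ≤
        4 * σ * √(2 * T * (dr * dc) * Real.log T)) ∧
    -- the same for the gap-dependent bound, when some arm is not optimal
    ((∃ a : Fin dr × Fin dc, 0 < LowRankBandit.armGap B a) →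
      MonotoneOn (LowRankBandit.phi2Gap B T) (LowRankBandit.resolutionRange B b α₄ α₅ T) ∧
      (∀ h ∈ LowRankBandit.resolutionRange B b α₄ α₅ T,
        LowRankBandit.regretBoundGap B b C₁ α₂ T h =
          LowRankBandit.regretBoundGapRho B b C₁ T (LowRankBandit.forcedRho B α₂ h) h) ∧
      ((∀ h ∈ LowRankBandit.resolutionRange B b α₄ α₅ T,
          LowRankBandit.phi1 B b C₁ α₂ T h < LowRankBandit.phi2Gap B T h) →
        LowRankBandit.OptimalUpToTwo (LowRankBandit.regretBoundGap B b C₁ α₂ T)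
          (LowRankBandit.resolutionRange B b α₄ α₅ T) (LowRankBandit.hLow B α₄ α₅ T) ∧
        LowRankBandit.regretBoundGap B b C₁ α₂ T (LowRankBandit.hLow B α₄ α₅ T) ≤
          2 * (8 * LowRankBandit.nearOptFun B (LowRankBandit.hLow B α₄ α₅ T) * Real.log T /
              LowRankBandit.minGap B +
            (1 + Real.pi ^ 2 / 3) * LowRankBandit.hLow B α₄ α₅ T *
              LowRankBandit.nearOptFun B (LowRankBandit.hLow B α₄ α₅ T))) ∧
      (∀ h' ∈ LowRankBandit.resolutionRange B b α₄ α₅ T,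
        LowRankBandit.phi1 B b C₁ α₂ T h' = LowRankBandit.phi2Gap B T h' →
        LowRankBandit.OptimalUpToTwo (LowRankBandit.regretBoundGap B b C₁ α₂ T)
          (LowRankBandit.resolutionRange B b α₄ α₅ T) h') ∧
      ((∀ h ∈ LowRankBandit.resolutionRange B b α₄ α₅ T,
          LowRankBandit.phi2Gap B T h < LowRankBandit.phi1 B b C₁ α₂ T h) →
        LowRankBandit.OptimalUpToTwo (LowRankBandit.regretBoundGap B b C₁ α₂ T)
          (LowRankBandit.resolutionRange B b α₄ α₅ T) (2 * b) ∧
        LowRankBandit.regretBoundGapRho B b C₁ T 0 (2 * b) ≤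
          8 * (dr * dc) * Real.log T / LowRankBandit.minGap B +
            (1 + Real.pi ^ 2 / 3) * (2 * b) * (dr * dc))) := by
  have hb0 : 0 ≤ b := (LowRankBandit.rowNorm_pos hB).le.trans hb
  have hpos : LowRankBandit.resolutionRange B b α₄ α₅ T ⊆ Set.Ioi 0 := fun h hh =>
    (LowRankBandit.hLow_pos α₄ hα₅ hT).trans_le hh.1
  have hl : LowRankBandit.hLow B α₄ α₅ T ∈ LowRankBandit.resolutionRange B b α₄ α₅ T :=
    Set.left_mem_Icc.2 hrange
  have hu : 2 * b ∈ LowRankBandit.resolutionRange B b α₄ α₅ T := Set.right_mem_Icc.2 hrange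
  have hf := (LowRankBandit.phi1_antitoneOn hB hb0 hC₁.le hα₂.le T).mono hpos
  have hf0 : ∀ h ∈ LowRankBandit.resolutionRange B b α₄ α₅ T,
      0 ≤ LowRankBandit.phi1 B b C₁ α₂ T h := fun h _ =>
    LowRankBandit.phi1_nonneg hb0 hC₁.le hα₂.le T h
  have hg := (LowRankBandit.phi2_mono (B := B) hσ.le T).monotoneOn
    (LowRankBandit.resolutionRange B b α₄ α₅ T)
  have hg0 : ∀ h ∈ LowRankBandit.resolutionRange B b α₄ α₅ T,
      0 ≤ LowRankBandit.phi2 B σ T h := fun h _ => LowRankBandit.phi2_nonneg hσ.le T h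
  refine ⟨⟨hf, hg⟩, fun h _ => ?_, fun hlt => ⟨?_, ?_⟩, fun h' hh' heq => ?_,
    fun hlt => ⟨?_, ?_⟩, fun hgap => ?_⟩
  · rw [LowRankBandit.regretBound, LowRankBandit.phi1_eq_phi1Rho, LowRankBandit.regretBoundRho]
  · exact LowRankBandit.optimalUpToTwo_left hrange hg hf0 (hlt _ hl).le
  · have h₁ := hlt _ hl
    rw [LowRankBandit.regretBound]
    rw [LowRankBandit.phi2] at h₁ ⊢
    linarith
  · exact LowRankBandit.optimalUpToTwo_of_eq hh' hf hg hf0 hg0 heq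
  · exact LowRankBandit.optimalUpToTwo_right hrange hf hg0 (hlt _ hu).le
  · rw [LowRankBandit.regretBoundRho, LowRankBandit.phi1Rho_zero, zero_add]
    exact LowRankBandit.phi2_le hσ.le T _
  · have hΔ := LowRankBandit.minGap_pos hgap
    have hG := (LowRankBandit.phi2Gap_monotoneOn hΔ T).mono hpos
    have hG0 : ∀ h ∈ LowRankBandit.resolutionRange B b α₄ α₅ T,
        0 ≤ LowRankBandit.phi2Gap B T h := fun h hh =>
      LowRankBandit.phi2Gap_nonneg hΔ T (hpos hh).le
    refine ⟨hG, fun h _ => ?_, fun hlt => ⟨?_, ?_⟩, fun h' hh' heq => ?_, fun hlt => ⟨?_, ?_⟩⟩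
    · rw [LowRankBandit.regretBoundGap, LowRankBandit.phi1_eq_phi1Rho,
        LowRankBandit.regretBoundGapRho]
    · exact LowRankBandit.optimalUpToTwo_left hrange hG hf0 (hlt _ hl).le
    · have h₁ := hlt _ hl
      rw [LowRankBandit.regretBoundGap]
      rw [LowRankBandit.phi2Gap] at h₁ ⊢
      linarith
    · exact LowRankBandit.optimalUpToTwo_of_eq hh' hf hG hf0 hG0 heq
    · exact LowRankBandit.optimalUpToTwo_right hrange hf hG0 (hlt _ hu).le
    · rw [LowRankBandit.regretBoundGapRho, LowRankBandit.phi1Rho_zero, zero_add]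
      exact LowRankBandit.phi2Gap_le hΔ T (hpos hu).le
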